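/- Let $U\subset\mathbb G_m$ be a non-empty Zariski-open subset of the multiplicative group over $\mathbb C$, that is $U=\mathbb C\setminus(\{0\}\cup S)$ with $S$ a finite set, and let $t$ be the coordinate on $\mathbb G_m$. Let $M$ be an algebraic connection on $U$: a finitely generated projective $\mathcal O_U$-module with a map $\nabla:M\to M\otimes\Omega^1_U$ satisfying the Leibniz rule (no assumption on the singularities of $\nabla$ is needed). Let $\mathcal M^\vee$ be its local system of solutions, i.e. of horizontal sections $\varepsilon$ of the analytic dual connection, so that $d\langle m,\varepsilon\rangle=\langle\nabla m,\varepsilon\rangle$ for $m\in M$. Fix a base point $p\in U$, a value of $\log p$ (hence a branch at $p$ of $t^s$ for every $s\in\mathbb C$), and a subfield $K\subset\mathbb C$ over which $\mathcal M^\vee$ is defined, i.e. a $K$-subspace $\mathcal M^\vee_{p,K}$ of the stalk $\mathcal M^\vee_p$, stable under the monodromy action of $\pi_1(U,p)$, with $\mathbb C\otimes_K\mathcal M^\vee_{p,K}\cong\mathcal M^\vee_p$. Let $R=K[e^{\pm2\pi i s}]$, a ring of functions of $s\in\mathbb C$, and let $\pi_1(U,p)$ act on $\mathcal M^\vee_{p,K}\otimes_K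 R$ by $\sigma(\varepsilon\otimes r)=\sigma\varepsilon\otimes e^{2\pi i s\,n(\sigma)}r$, where $n(\sigma)$ is the winding number of $\sigma$ around $0$, and $\sigma\varepsilon$ is the continuation of $\varepsilon$ along $\sigma$. Put $$H_1(U,\mathcal M^\vee\otimes t^s)=H_1\bigl(\pi_1(U,p),\ \mathcal M^\vee_{p,K}\otimes_K R\bigr).$$ Fix $m\in M$. A class $\xi\in H_1(U,\mathcal M^\vee\otimes t^s)$ is represented by a $1$-cycle $\sum_j\sigma_j\otimes\varepsilon_j\otimes e^{2\pi i s n_j}$ (a finite sum with loops $\sigma_j$ at $p$, $\varepsilon_j\in\mathcal M^\vee_{p,K}$, $n_j\in\mathbb Z$; the boundary of $\sigma\otimes v$ is $\sigma v-v$), and the gamma function attached to $m\otimes\frac{dt}t$ and $\xi$ is $$\Gamma_\xi(s)=\sum_j e^{2\pi i s n_j}\int_{\sigma_j}\langle m,\varepsilon_j\rangle\,t^{s-1}\,dt ,$$ where each $\sigma_j$ is represented by a piecewise $C^1$ loop, and $\varepsilon_j$ and $t^{s}$ are continued along $\sigma_j$, starting from the fixed branch at $p$. Then the set of all functions $\Gamma_\xi$,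 $\xi\in H_1(U,\mathcal M^\vee\otimes t^s)$, is a finitely generated $K[e^{\pm2\pi i s}]$-submodule of the module of functions $\mathbb C\to\mathbb C$. -/

import Mathlib

open scoped TensorProduct

noncomputable section

namespace MotivicGamma

/-! ### The curve `U` and its algebraic connections -/

/-- The Zariski-open curve `U = 𝔾ₘ ∖ S` (as a topological space: `ℂ ∖ ({0} ∪ S)`), where `S` is an
arbitrary finite set.  The coordinate on `𝔾ₘ` is denoted `t`. -/
abbrev Curve (S : Finset ℂ) : Type := {z : ℂ // z ≠ 0 ∧ z ∉ S}

/-- The polynomial `t ∏_{a ∈ S} (t - a)`, whose non-vanishing locus is `U`. -/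
def discr (S : Finset ℂ) : Polynomial ℂ :=
  Polynomial.X * ∏ a ∈ S, (Polynomial.X - Polynomial.C a)

/-- The ring `𝒪_U` of regular functions on `U`: the localization of `ℂ[t]` at `discr S`. -/
abbrev Reg (S : Finset ℂ) : Type := Localization.Away (discr S)

lemma isUnit_eval_discr (S : Finset ℂ) (z : Curve S) :
    IsUnit (Polynomial.evalRingHom z.1 (discr S)) := by
  have h : ∀ a ∈ S, z.1 - a ≠ 0 := fun a ha h0 => z.2.2 (by rwa [sub_eq_zero.mp h0])
  simp only [discr, Polynomial.coe_evalRingHom, Polynomial.eval_mul, Polynomial.eval_X,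
    Polynomial.eval_prod, Polynomial.eval_sub, Polynomial.eval_C]
  exact (mul_ne_zero z.2.1 (Finset.prod_ne_zero_iff.mpr h)).isUnit

/-- The value `f(z)` of a regular function at a point of `U`. -/
def evalAt {S : Finset ℂ} (z : Curve S) : Reg S →+* ℂ :=
  IsLocalization.Away.lift (discr S) (isUnit_eval_discr S z)

/-- Contraction of a regular differential form with the vector field `d/dt`, that is
`g dt ↦ g`. -/
def contractForm (S : Finset ℂ) : Ω[Reg S⁄ℂ] →ₗ[Reg S] Reg S :=
  haveI : Algebra.FormallyEtale (Polynomial ℂ) (Reg S) :=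
    Algebra.FormallyEtale.of_isLocalization (Submonoid.powers (discr S))
  (TensorProduct.AlgebraTensorModule.rid (Polynomial ℂ) (Reg S) (Reg S)).toLinearMap ∘ₗ
    TensorProduct.AlgebraTensorModule.map (LinearMap.id : Reg S →ₗ[Reg S] Reg S)
      (Polynomial.derivative' (R := ℂ)).liftKaehlerDifferential ∘ₗ
    (KaehlerDifferential.tensorKaehlerEquivOfFormallyEtale
      ℂ (Polynomial ℂ) (Reg S)).symm.toLinearMap

lemma contractForm_D (S : Finset ℂ) (q : Polynomial ℂ) :
    contractForm S (KaehlerDifferential.D ℂ (Reg S) (algebraMap (Polynomial ℂ) (Reg S) q)) =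
      algebraMap (Polynomial ℂ) (Reg S) (Polynomial.derivative q) := by
  have : Algebra.FormallyEtale (Polynomial ℂ) (Reg S) :=
    Algebra.FormallyEtale.of_isLocalization (Submonoid.powers (discr S))
  simp only [contractForm, LinearMap.comp_apply, LinearEquiv.coe_coe,
    KaehlerDifferential.tensorKaehlerEquivOfFormallyEtale_symm_D_algebraMap,
    TensorProduct.AlgebraTensorModule.map_tmul, Derivation.liftKaehlerDifferential_comp_D,
    TensorProduct.AlgebraTensorModule.rid_tmul, LinearMap.id_apply]
  rw [Algebra.smul_def, mul_one]
  rfl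

/-- An algebraic connection `∇ : M → M ⊗ Ω¹_U` on an `𝒪_U`-module `M`
(`ℂ`-linearity follows from additivity and the Leibniz rule). -/
structure AlgConnection (S : Finset ℂ) (M : Type) [AddCommGroup M] [Module (Reg S) M] where
  /-- the map `∇` -/
  nabla : M →+ M ⊗[Reg S] Ω[Reg S⁄ℂ]
  leibniz : ∀ (f : Reg S) (m : M),
    nabla (f • m) = f • nabla m + m ⊗ₜ[Reg S] KaehlerDifferential.D ℂ (Reg S) f

/-- The covariant derivative `∇_{d/dt} : M → M`. -/
def AlgConnection.ddt {S : Finset ℂ} {M : Type} [AddCommGroup M] [Module (Reg S) M]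
    (D : AlgConnection S M) : M →+ M :=
  (((TensorProduct.rid (Reg S) M).toLinearMap ∘ₗ
    LinearMap.lTensor M (contractForm S)).toAddMonoidHom).comp D.nabla

/-! ### Multivalued functions and the local system of solutions -/

/-- Multivalued functions on `U`, based at `p`: functions on the universal cover of `U`, whose
points are the pairs of a point `z ∈ U` and a homotopy class of paths from `p` to `z`. -/
abbrev Multi {S : Finset ℂ} (p : Curve S) : Type :=
  ∀ z : Curve S, Path.Homotopic.Quotient p z → ℂ

/-- `g` is the branch of the multivalued function `f` near the point `(z, c)` of the universal
cover: continuing `f` from `(z, c)` along short paths gives the values of `g`. -/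
def IsBranchAt {S : Finset ℂ} {p : Curve S} (f : Multi p) (z : Curve S)
    (c : Path.Homotopic.Quotient p z) (g : ℂ → ℂ) : Prop :=
  ∃ V : Set (Curve S), IsOpen V ∧ z ∈ V ∧
    ∀ (w : Curve S) (d : Path z w), (∀ x, d x ∈ V) →
      f w (c.trans (Path.Homotopic.Quotient.mk d)) = g w.1

/-- `f` is holomorphic on the universal cover with derivative `df/dt = f'`. -/
def HasMultiDeriv {S : Finset ℂ} {p : Curve S} (f f' : Multi p) : Prop :=
  ∀ (z : Curve S) (c : Path.Homotopic.Quotient p z),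
    ∃ g : ℂ → ℂ, IsBranchAt f z c g ∧ HasDerivAt g (f' z c) z.1

lemma HasMultiDeriv.add {S : Finset ℂ} {p : Curve S} {f f' g g' : Multi p}
    (hf : HasMultiDeriv f f') (hg : HasMultiDeriv g g') : HasMultiDeriv (f + g) (f' + g') := by
  intro z c
  obtain ⟨u, ⟨V, hV, hzV, hu⟩, hu'⟩ := hf z c
  obtain ⟨v, ⟨W, hW, hzW, hv⟩, hv'⟩ := hg z c
  exact ⟨u + v, ⟨V ∩ W, hV.inter hW, ⟨hzV, hzW⟩, fun w d hd => by
    simp [hu w d fun x => (hd x).1, hv w d fun x => (hd x).2]⟩, hu'.add hv'⟩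

lemma HasMultiDeriv.smul {S : Finset ℂ} {p : Curve S} (a : ℂ) {f f' : Multi p}
    (hf : HasMultiDeriv f f') : HasMultiDeriv (a • f) (a • f') := by
  intro z c
  obtain ⟨u, ⟨V, hV, hzV, hu⟩, hu'⟩ := hf z c
  exact ⟨a • u, ⟨V, hV, hzV, fun w d hd => by simp [hu w d hd]⟩, hu'.const_smul a⟩

lemma HasMultiDeriv.zero {S : Finset ℂ} {p : Curve S} :
    HasMultiDeriv (0 : Multi p) (0 : Multi p) := fun z _ =>
  ⟨0, ⟨Set.univ, isOpen_univ, trivial, fun _ _ _ => rfl⟩, hasDerivAt_const z.1 0⟩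

/-- Continuation of a multivalued function along the loop `σ`: near `p` the result is the
continuation of `f` along `σ`. -/
def Multi.cont {S : Finset ℂ} {p : Curve S} (σ : FundamentalGroup (Curve S) p) (f : Multi p) :
    Multi p :=
  fun z c => f z (σ.toPath.trans c)

lemma HasMultiDeriv.cont {S : Finset ℂ} {p : Curve S} (σ : FundamentalGroup (Curve S) p)
    {f f' : Multi p} (hf : HasMultiDeriv f f') : HasMultiDeriv (f.cont σ) (f'.cont σ) := by
  intro z c
  obtain ⟨u, ⟨V, hV, hzV, hu⟩, hu'⟩ := hf z (σ.toPath.trans c)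
  refine ⟨u, ⟨V, hV, hzV, fun w d hd => ?_⟩, hu'⟩
  rw [← hu w d hd]
  exact congrArg (f w) (Path.Homotopic.Quotient.trans_assoc _ _ _).symm

section Solutions

variable {S : Finset ℂ} {M : Type} [AddCommGroup M] [Module (Reg S) M]

/-- The space of solutions of `M`: horizontal sections `ε` of the analytic dual `M^∨`, i.e.
`𝒪_U`-linear maps `m ↦ ⟨m, ε⟩` into holomorphic functions with
`d⟨m, ε⟩/dt = ⟨∇_{d/dt} m, ε⟩`.  Solutions are germs at the base point `p`, which are recorded
together with their analytic continuation, i.e. as horizontal sections on the universal cover of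
`U`.  So this is the stalk at `p` of the local system `𝓜^∨`. -/
def Sol (D : AlgConnection S M) (p : Curve S) : Submodule ℂ (M → Multi p) where
  carrier := {ε | (∀ m m', ε (m + m') = ε m + ε m') ∧
    (∀ (f : Reg S) m z c, ε (f • m) z c = evalAt z f * ε m z c) ∧
    ∀ m, HasMultiDeriv (ε m) (ε (D.ddt m))}
  zero_mem' := ⟨by simp, by simp, fun _ => HasMultiDeriv.zero⟩
  add_mem' := by
    rintro a b ⟨h1, h2, h3⟩ ⟨k1, k2, k3⟩
    refine ⟨fun m m' => ?_, fun f m z c => ?_, fun m => (h3 m).add (k3 m)⟩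
    · simp only [Pi.add_apply, h1, k1]; abel
    · simp only [Pi.add_apply, h2, k2]; ring
  smul_mem' := by
    rintro x a ⟨h1, h2, h3⟩
    refine ⟨fun m m' => ?_, fun f m z c => ?_, fun m => (h3 m).smul x⟩
    · simp only [Pi.smul_apply, h1, smul_add]
    · simp only [Pi.smul_apply, h2, smul_eq_mul]; ring

/-- The pairing `⟨m, ε⟩`, a multivalued function on `U`. -/
def pair {D : AlgConnection S M} {p : Curve S} (m : M) (ε : Sol D p) : Multi p := ε.1 m

/-- The monodromy action of `π₁(U, p)` on solutions: `σ ε` is the continuation of `ε` along `σ`.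
(Mathlib's product `σ * τ` in `π₁` is the loop `τ` followed by `σ`.) -/
def solMonodromy (D : AlgConnection S M) (p : Curve S) :
    Representation ℂ (FundamentalGroup (Curve S) p) (Sol D p) where
  toFun σ :=
    { toFun := fun ε => ⟨fun m => (ε.1 m).cont σ, by
        obtain ⟨h1, h2, h3⟩ := ε.2
        refine ⟨fun m m' => ?_, fun f m z c => ?_, fun m => (h3 m).cont σ⟩
        · exact funext fun z => funext fun c => congrFun (congrFun (h1 m m') z) _
        · exact h2 f m z _⟩
      map_add' := fun _ _ => rfl
      map_smul' := fun _ _ => rfl }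
  map_one' := by
    ext ε : 2
    funext m z c
    exact congrArg (ε.1 m z) (Path.Homotopic.Quotient.refl_trans c)
  map_mul' σ τ := by
    ext ε : 2
    funext m z c
    exact congrArg (ε.1 m z)
      (Path.Homotopic.Quotient.trans_assoc τ.toPath σ.toPath c)

/-- A `K`-structure on the local system `𝓜^∨`: a `K`-subspace `L` of the stalk at `p` which is
stable under monodromy and satisfies `ℂ ⊗_K L ≅ 𝓜^∨_p`. -/
structure KStructure (K : Subfield ℂ) (D : AlgConnection S M) (p : Curve S) where
  /-- the space of `K`-rational solutions -/
  L : Submodule K (Sol D p)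
  stable : ∀ σ, ∀ ε ∈ L, solMonodromy D p σ ε ∈ L
  isBaseChange : IsBaseChange ℂ L.subtype

/-- The monodromy representation on the `K`-rational solutions. -/
def KStructure.monodromy {K : Subfield ℂ} {D : AlgConnection S M} {p : Curve S}
    (𝓛 : KStructure K D p) : Representation K (FundamentalGroup (Curve S) p) 𝓛.L where
  toFun σ := ((solMonodromy D p σ).restrictScalars K).restrict (𝓛.stable σ)
  map_one' := by
    ext ε : 2
    exact congrFun (congrArg DFunLike.coe (solMonodromy D p).map_one) ε.1
  map_mul' σ τ := by
    ext ε : 2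
    exact congrFun (congrArg DFunLike.coe ((solMonodromy D p).map_mul σ τ)) ε.1

end Solutions

/-! ### The connection `t^s` -/

/-- A branch of `log t` (equivalently, of `t^s = exp (s log t)` for all `s`) at `p`: a value
of `log p`. -/
abbrev LogBranch {S : Finset ℂ} (p : Curve S) : Type := {l : ℂ // Complex.exp l = p.1}

/-- The inclusion of `U` into `𝔾ₘ`. -/
def toGm (S : Finset ℂ) : C(Curve S, {z : ℂ // z ≠ 0}) :=
  ⟨fun z => ⟨z.1, z.2.1⟩, by fun_prop⟩

/-- The multivalued function `log t` on `U` with the given branch at `p`: the value at `(z, c)` is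
the endpoint of the lift of `c` along the covering `exp : ℂ → ℂ ∖ {0}`, starting at the given
value of `log p`. -/
def mlog {S : Finset ℂ} {p : Curve S} (l : LogBranch p) : Multi p := fun _ c =>
  (Complex.isCoveringMap_exp.monodromy (c.map (toGm S)) ⟨l.1, Subtype.ext l.2⟩).1

/-- The multivalued function `t^s`. -/
def tpow {S : Finset ℂ} {p : Curve S} (l : LogBranch p) (s : ℂ) : Multi p :=
  fun z c => Complex.exp (s * mlog l z c)

lemma exp_mlog {S : Finset ℂ} {p : Curve S} (l : LogBranch p) (z : Curve S)
    (c : Path.Homotopic.Quotient p z) : Complex.exp (mlog l z c) = z.1 :=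
  congrArg Subtype.val
    (Complex.isCoveringMap_exp.monodromy (c.map (toGm S)) ⟨l.1, Subtype.ext l.2⟩).2

/-- Continuation of `log t` along a loop `σ` adds `2πi n` for an integer `n`. -/
lemma exists_winding {S : Finset ℂ} {p : Curve S} (l : LogBranch p)
    (σ : FundamentalGroup (Curve S) p) :
    ∃ n : ℤ, ∀ z c, (mlog l).cont σ z c = mlog l z c + n * (2 * Real.pi * Complex.I) := by
  have hq := Complex.isAddQuotientCoveringMap_exp
  obtain ⟨n, hn⟩ := Complex.exp_eq_exp_iff_exists_int.mp
    ((exp_mlog l p σ.toPath).trans l.2.symm)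
  refine ⟨n, fun z c => ?_⟩
  let a : AddSubgroup.zmultiples (2 * Real.pi * Complex.I : ℂ) :=
    ⟨n * (2 * Real.pi * Complex.I), AddSubgroup.mem_zmultiples_iff.mpr ⟨n, by simp⟩⟩
  have h1 := congrArg Subtype.val (hq.monodromy_toPermFiber (γ := c.map (toGm S))
    (e := ⟨l.1, Subtype.ext l.2⟩) (g := Multiplicative.ofAdd a))
  have h2 : (σ.toPath.trans c).map (toGm S) =
      (σ.toPath.map (toGm S)).trans (c.map (toGm S)) :=
    (FundamentalGroupoid.map (toGm S)).map_comp (X := .mk p) (Y := .mk p) (Z := .mk z)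
      σ.toPath c
  have h3 : Complex.isCoveringMap_exp.monodromy (σ.toPath.map (toGm S))
      ⟨l.1, Subtype.ext l.2⟩ = hq.toMultiplicative.toPermFiber (toGm S p)
        (Multiplicative.ofAdd a) ⟨l.1, Subtype.ext l.2⟩ := by
    apply Subtype.ext
    exact hn.trans (add_comm _ _)
  simp only [Multi.cont, mlog]
  rw [h2, IsCoveringMap.monodromy_trans_apply, h3]
  exact h1.trans (add_comm _ _)

/-- The integer `n(σ)` with `σ(t^s) = e^{2πi s n(σ)} t^s`. -/
def winding {S : Finset ℂ} {p : Curve S} (l : LogBranch p)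
    (σ : FundamentalGroup (Curve S) p) : ℤ := (exists_winding l σ).choose

lemma winding_spec {S : Finset ℂ} {p : Curve S} (l : LogBranch p)
    (σ : FundamentalGroup (Curve S) p) (z : Curve S) (c : Path.Homotopic.Quotient p z) :
    (mlog l).cont σ z c = mlog l z c + winding l σ * (2 * Real.pi * Complex.I) :=
  (exists_winding l σ).choose_spec z c

lemma winding_one {S : Finset ℂ} {p : Curve S} (l : LogBranch p) : winding l 1 = 0 := by
  have h := winding_spec l 1 p (.refl p)
  have h' : (mlog l).cont 1 p (.refl p) = mlog l p (.refl p) :=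
    congrArg (mlog l p) (Path.Homotopic.Quotient.refl_trans _)
  rw [h', left_eq_add] at h
  simpa [Complex.two_pi_I_ne_zero] using h

lemma winding_mul {S : Finset ℂ} {p : Curve S} (l : LogBranch p)
    (σ τ : FundamentalGroup (Curve S) p) :
    winding l (σ * τ) = winding l σ + winding l τ := by
  have h := winding_spec l (σ * τ) p (.refl p)
  have h' : (mlog l).cont (σ * τ) p (.refl p) =
      (mlog l).cont τ p (σ.toPath.trans (.refl p)) :=
    congrArg (mlog l p) (Path.Homotopic.Quotient.trans_assoc τ.toPath σ.toPath _)
  have h'' : mlog l p (σ.toPath.trans (.refl p)) = (mlog l).cont σ p (.refl p) := rfl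
  rw [h', winding_spec, h'', winding_spec, add_assoc, add_right_inj, ← add_mul] at h
  have := mul_right_cancel₀ Complex.two_pi_I_ne_zero h
  exact_mod_cast this.symm

/-- The function `s ↦ e^{2πi s n}`. -/
def e (n : ℤ) : ℂ → ℂ := fun s => Complex.exp (2 * Real.pi * Complex.I * s * n)

/-- The ring `K[e^{±2πis}]` of functions of `s`. -/
abbrev R (K : Subfield ℂ) : Subalgebra K (ℂ → ℂ) := Algebra.adjoin K {e 1, e (-1)}

lemma e_add (m n : ℤ) : e (m + n) = e m * e n := by
  funext s
  simp only [e, Pi.mul_apply, ← Complex.exp_add]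
  push_cast; ring_nf

lemma e_zero : e 0 = 1 := by
  funext s; simp [e]

lemma e_mem (K : Subfield ℂ) (n : ℤ) : e n ∈ R K := by
  induction n using Int.induction_on with
  | zero => rw [e_zero]; exact one_mem _
  | succ i ih => rw [e_add]; exact mul_mem ih (Algebra.subset_adjoin (by simp))
  | pred i ih => rw [sub_eq_add_neg, e_add]; exact mul_mem ih (Algebra.subset_adjoin (by simp))

/-- `e^{2πi s n}` as an element of `K[e^{±2πis}]`. -/
def eR (K : Subfield ℂ) (n : ℤ) : R K := ⟨e n, e_mem K n⟩

lemma eR_zero (K : Subfield ℂ) : eR K 0 = 1 := Subtype.ext e_zero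

lemma eR_add (K : Subfield ℂ) (m n : ℤ) : eR K (m + n) = eR K m * eR K n :=
  Subtype.ext (e_add m n)

/-! ### Homology of `𝓜^∨ ⊗ t^s` -/

/-- The extension of scalars to `A` of a `k`-linear representation, twisted by a character
with values in `A`: `g (a ⊗ v) = χ(g) a ⊗ g v`. -/
def twist {k A G V : Type*} [CommRing k] [CommRing A] [Algebra k A] [Group G] [AddCommGroup V]
    [Module k V] (χ : G →* A) (ρ : Representation k G V) : Representation A G (A ⊗[k] V) where
  toFun g := TensorProduct.AlgebraTensorModule.map (LinearMap.mulLeft A (χ g)) (ρ g)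
  map_one' := by ext; simp
  map_mul' g h := by ext; simp

section Homology

variable {S : Finset ℂ} {M : Type} [AddCommGroup M] [Module (Reg S) M]
  {K : Subfield ℂ} {D : AlgConnection S M} {p : Curve S}

/-- The stalk at `p` of `𝓜^∨ ⊗ t^s`, the free `K[e^{±2πis}]`-module `K[e^{±2πis}] ⊗_K 𝓜^∨_p`. -/
def Stalk (𝓛 : KStructure K D p) : Type := R K ⊗[K] 𝓛.L

instance (𝓛 : KStructure K D p) : AddCommGroup (Stalk 𝓛) :=
  inferInstanceAs (AddCommGroup (R K ⊗[K] 𝓛.L))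

instance (𝓛 : KStructure K D p) : Module (R K) (Stalk 𝓛) :=
  inferInstanceAs (Module (R K) (R K ⊗[K] 𝓛.L))

/-- The element `r ⊗ ε` of the stalk. -/
def Stalk.tmul (𝓛 : KStructure K D p) (r : R K) (ε : 𝓛.L) : Stalk 𝓛 := r ⊗ₜ[K] ε

/-- The monodromy of `t^s`, as a character `σ ↦ e^{2πi s n(σ)}`. -/
def character (K : Subfield ℂ) (l : LogBranch p) : FundamentalGroup (Curve S) p →* R K where
  toFun σ := eR K (winding l σ)
  map_one' := by rw [winding_one, eR_zero]
  map_mul' σ τ := by rw [winding_mul, eR_add]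

/-- The monodromy action of `π₁(U, p)` on the stalk of `𝓜^∨ ⊗ t^s`:
`σ (r ⊗ ε) = (e^{2πi s n(σ)} r) ⊗ σ ε`. -/
def stalkMonodromy (𝓛 : KStructure K D p) (l : LogBranch p) :
    Representation (R K) (FundamentalGroup (Curve S) p) (Stalk 𝓛) :=
  twist (k := K) (A := R K) (V := 𝓛.L) (character K l) 𝓛.monodromy

lemma stalkMonodromy_tmul (𝓛 : KStructure K D p) (l : LogBranch p)
    (σ : FundamentalGroup (Curve S) p) (r : R K) (ε : 𝓛.L) :
    stalkMonodromy 𝓛 l σ (Stalk.tmul 𝓛 r ε) =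
      Stalk.tmul 𝓛 (eR K (winding l σ) * r) (𝓛.monodromy σ ε) :=
  rfl

/-- The homology group `H₁(U, 𝓜^∨ ⊗ t^s) = H₁(π₁(U, p), 𝓜^∨_p ⊗_K K[e^{±2πis}])`. -/
abbrev H1 (𝓛 : KStructure K D p) (l : LogBranch p) : ModuleCat (R K) :=
  groupHomology.H1 (Rep.of (stalkMonodromy 𝓛 l))

/-- The `1`-chain `σ ⊗ v` of the inhomogeneous bar complex, normalized so that its boundary is
`σ v - v`.  (Mathlib's bar complex turns a left module into a right module through `g ↦ g⁻¹`, which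
is why the inverse appears.) -/
def chain (𝓛 : KStructure K D p) (σ : FundamentalGroup (Curve S) p) (v : Stalk 𝓛) :
    FundamentalGroup (Curve S) p →₀ Stalk 𝓛 :=
  Finsupp.single σ⁻¹ v

lemma d₁₀_chain (𝓛 : KStructure K D p) (l : LogBranch p) (σ : FundamentalGroup (Curve S) p)
    (v : Stalk 𝓛) :
    groupHomology.d₁₀ (Rep.of (stalkMonodromy 𝓛 l)) (chain 𝓛 σ v) =
      stalkMonodromy 𝓛 l σ v - v := by
  rw [chain, groupHomology.d₁₀_single, inv_inv]

/-! ### Gamma functions -/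

/-- A loop in `U` is piecewise `C¹`. -/
def PiecewiseC1 (γ : Path p p) : Prop :=
  ∃ (n : ℕ) (a : ℕ → ℝ), Monotone a ∧ a 0 = 0 ∧ a n = 1 ∧
    ∀ i < n, ContDiffOn ℝ 1 (fun x => (γ.extend x : ℂ)) (Set.Icc (a i) (a (i + 1)))

/-- The integral `∫_γ f dt` of a multivalued function, where `f` is continued along `γ`:
at the time `x` its value is the one at the point `γ(x)` reached along `γ|_[0,x]`. -/
def loopIntegral (f : Multi p) (γ : Path p p) : ℂ :=
  ∫ x in (0 : ℝ)..1,
    f (γ (Set.projIcc 0 1 zero_le_one x))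
      (Path.Homotopic.Quotient.mk
        ((γ.subpath 0 (Set.projIcc 0 1 zero_le_one x)).cast γ.source.symm rfl)) *
    deriv (fun y => (γ.extend y : ℂ)) x

/-- `G` is the gamma function attached to `m ⊗ dt/t` and the homology class `ξ`: for a `1`-cycle
`∑ⱼ σⱼ ⊗ εⱼ ⊗ e^{2πi s nⱼ}` that represents `ξ`, with the loops `σⱼ` given by piecewise `C¹` paths,
`G(s) = ∑ⱼ e^{2πi s nⱼ} ∫_{σⱼ} ⟨m, εⱼ⟩ t^{s-1} dt`. -/
def IsGammaFunction (𝓛 : KStructure K D p) (l : LogBranch p) (m : M) (ξ : H1 𝓛 l)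
    (G : ℂ → ℂ) : Prop :=
  ∃ (k : ℕ) (σ : Fin k → Path p p) (ε : Fin k → 𝓛.L) (n : Fin k → ℤ)
    (z : groupHomology.cycles₁ (Rep.of (stalkMonodromy 𝓛 l))),
    (∀ j, PiecewiseC1 (σ j)) ∧
    (z : FundamentalGroup (Curve S) p →₀ Stalk 𝓛) =
      ∑ j, chain 𝓛 (FundamentalGroup.fromPath (Path.Homotopic.Quotient.mk (σ j)))
        (Stalk.tmul 𝓛 (eR K (n j)) (ε j)) ∧
    groupHomology.H1π (Rep.of (stalkMonodromy 𝓛 l)) z = ξ ∧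
    ∀ s, G s = ∑ j, e (n j) s * loopIntegral (pair m (ε j).1 * tpow l (s - 1)) (σ j)

end Homology

end MotivicGamma

end

open scoped TensorProduct

noncomputable section

namespace MotivicGamma

section Development

/-! ### Straight paths in `U` -/

/-! The ring `R K` is a finitely generated algebra over a field, hence Noetherian. The gamma
functions form an `R K`-submodule, because chains can be concatenated and scaled. So it is enough to
place them all in one finitely generated module `W`, and for this it suffices that every single loop
integral `s ↦ ∫_γ ⟨m, ε⟩ t^{s-1} dt` lies in `W` (`exists_fg_loopIntegral_mem`).

Cover `U` by finitely many convex open cells. The solution space is finite-dimensional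
(`finite_sol`, by Grönwall), so `𝓛.L` has a finite `K`-basis. Two paths from `p` into the same cell
differ by a loop, and monodromy acts through `𝓛.L` and a power of `e^{2πis}`. Hence on a given cell
all branches of all integrands are `R K`-combinations of finitely many functions
(`IsCell.exists_develop_integrand_eq`). Fix primitives of these functions, separately for each `s`,
and let `W` be generated by their values at finitely many marked points: `p`, and one point in each
non-empty overlap of two cells.

Now follow a loop. The integral up to time `t`, minus a primitive at `γ t` whose values at marked
points lie in `W`, stays in `W`. Inside a cell this difference is constant by the fundamental
theorem of calculus; on passing to another cell it changes by the constant difference of two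
primitives, which can be read off at a marked point. Both ends of the loop are at `p`, so the
integral itself is in `W`. -/

/-- The underlying set of `U` in `ℂ`. -/
def domain (S : Finset ℂ) : Set ℂ := {z | z ≠ 0 ∧ z ∉ S}

lemma isOpen_domain (S : Finset ℂ) : IsOpen (domain S) :=
  isOpen_ne.inter S.finite_toSet.isClosed.isOpen_compl

/-- An open convex subset of `U`. -/
structure IsCell (S : Finset ℂ) (C : Set ℂ) : Prop where
  isOpen : IsOpen C
  convex : Convex ℝ C
  subset : C ⊆ domain S

lemma IsCell.inter {S : Finset ℂ} {C C' : Set ℂ} (h : IsCell S C) (h' : IsCell S C') :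
    IsCell S (C ∩ C') :=
  ⟨h.isOpen.inter h'.isOpen, h.convex.inter h'.convex, fun _ hz => h.subset hz.1⟩

lemma exists_isCell_mem {S : Finset ℂ} (x : Curve S) : ∃ C, IsCell S C ∧ x.1 ∈ C := by
  obtain ⟨r, hr, hsub⟩ := Metric.isOpen_iff.mp (isOpen_domain S) x.1 x.2
  exact ⟨Metric.ball x.1 r, ⟨Metric.isOpen_ball, convex_ball _ _, hsub⟩, Metric.mem_ball_self hr⟩

variable {S : Finset ℂ}

/-- The homotopy class of the straight path from `x` to `w`. -/
def link (x w : Curve S) (h : segment ℝ x.1 w.1 ⊆ domain S) : Path.Homotopic.Quotient x w :=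
  .mk
    { toFun := fun t => ⟨AffineMap.lineMap x.1 w.1 (t : ℝ), h (by
        rw [segment_eq_image_lineMap]; exact ⟨t, t.2, rfl⟩)⟩
      continuous_toFun := by
        refine Continuous.subtype_mk ?_ _
        exact AffineMap.lineMap_continuous.comp continuous_subtype_val
      source' := by ext; simp
      target' := by ext; simp }

/-- The straight-line homotopy stays in the convex set `C`, hence in `U`. -/
lemma IsCell.homotopic {C : Set ℂ} (hC : IsCell S C) {x w : Curve S} (d d' : Path x w)
    (hd : ∀ t, (d t).1 ∈ C) (hd' : ∀ t, (d' t).1 ∈ C) : d.Homotopic d' := by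
  have hmem : ∀ q : unitInterval × unitInterval,
      AffineMap.lineMap (d q.2).1 (d' q.2).1 (q.1 : ℝ) ∈ C := fun q =>
    hC.convex.lineMap_mem (hd _) (hd' _) q.1.2
  refine ⟨
    { toFun := fun q => ⟨AffineMap.lineMap (d q.2).1 (d' q.2).1 (q.1 : ℝ), hC.subset (hmem q)⟩
      continuous_toFun := ?_
      map_zero_left := ?_
      map_one_left := ?_
      prop' := ?_ }⟩
  · refine Continuous.subtype_mk ?_ _
    simp only [AffineMap.lineMap_apply_module']
    fun_prop
  · intro t; ext; simp
  · intro t; ext; simp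
  · rintro s t (rfl | rfl) <;> ext <;> simp

lemma IsCell.segment_subset {C : Set ℂ} (hC : IsCell S C) {x w : ℂ} (hx : x ∈ C) (hw : w ∈ C) :
    segment ℝ x w ⊆ domain S :=
  (hC.convex.segment_subset hx hw).trans hC.subset

lemma IsCell.mk_eq_link {C : Set ℂ} (hC : IsCell S C) {x w : Curve S} (d : Path x w)
    (hd : ∀ t, (d t).1 ∈ C) (h : segment ℝ x.1 w.1 ⊆ domain S) :
    Path.Homotopic.Quotient.mk d = link x w h := by
  have hx : x.1 ∈ C := by simpa using hd 0
  have hw : w.1 ∈ C := by simpa using hd 1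
  exact Path.Homotopic.Quotient.eq.mpr (hC.homotopic _ _ hd fun t =>
    hC.convex.lineMap_mem hx hw t.2)

lemma IsCell.link_trans_link {C : Set ℂ} (hC : IsCell S C) {x y w : Curve S} (hx : x.1 ∈ C)
    (hy : y.1 ∈ C) (hw : w.1 ∈ C) :
    (link x y (hC.segment_subset hx hy)).trans (link y w (hC.segment_subset hy hw)) =
      link x w (hC.segment_subset hx hw) := by
  rw [link, link, ← Path.Homotopic.Quotient.mk_trans]
  refine hC.mk_eq_link _ (fun t => ?_) _
  rw [Path.trans_apply]
  split_ifs
  · exact hC.convex.lineMap_mem hx hy (Subtype.prop _)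
  · exact hC.convex.lineMap_mem hy hw (Subtype.prop _)

/-! ### Developing a multivalued function along straight paths -/

variable {p : Curve S}

open Classical in
/-- The continuation of `f` from the point `(x, c)` of the universal cover along straight paths. -/
def develop (f : Multi p) {x : Curve S} (c : Path.Homotopic.Quotient p x) (w : ℂ) : ℂ :=
  -- The value `0` is junk; the analytic statements take `w` in a cell containing `x`.
  if h : segment ℝ x.1 w ⊆ domain S then
    f ⟨w, h (right_mem_segment ℝ x.1 w)⟩ (c.trans (link x ⟨w, _⟩ h)) else 0

lemma IsCell.develop_eq {C : Set ℂ} (hC : IsCell S C) (f : Multi p) {x w : Curve S}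
    (c : Path.Homotopic.Quotient p x) (hx : x.1 ∈ C) (hw : w.1 ∈ C) :
    develop f c w.1 = f w (c.trans (link x w (hC.segment_subset hx hw))) :=
  dif_pos (hC.segment_subset hx hw)

lemma IsCell.develop_eq_path {C : Set ℂ} (hC : IsCell S C) (f : Multi p) {x w : Curve S}
    (c : Path.Homotopic.Quotient p x) (d : Path x w) (hd : ∀ t, (d t).1 ∈ C) :
    develop f c w.1 = f w (c.trans (.mk d)) := by
  have hx : x.1 ∈ C := by simpa using hd 0
  have hw : w.1 ∈ C := by simpa using hd 1
  rw [hC.develop_eq f c hx hw, hC.mk_eq_link d hd (hC.segment_subset hx hw)]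

lemma IsCell.develop_trans_link {C : Set ℂ} (hC : IsCell S C) (f : Multi p) {x y : Curve S}
    (c : Path.Homotopic.Quotient p x) (hx : x.1 ∈ C) (hy : y.1 ∈ C) {w : ℂ} (hw : w ∈ C) :
    develop f (c.trans (link x y (hC.segment_subset hx hy))) w = develop f c w := by
  lift w to Curve S using hC.subset hw
  rw [hC.develop_eq f _ hy hw, hC.develop_eq f _ hx hw, Path.Homotopic.Quotient.trans_assoc,
    hC.link_trans_link hx hy hw]

lemma IsCell.develop_trans_path {C : Set ℂ} (hC : IsCell S C) (f : Multi p) {x y : Curve S}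
    (c : Path.Homotopic.Quotient p x) (d : Path x y) (hd : ∀ t, (d t).1 ∈ C) {w : ℂ}
    (hw : w ∈ C) : develop f (c.trans (.mk d)) w = develop f c w := by
  have hx : x.1 ∈ C := by simpa using hd 0
  have hy : y.1 ∈ C := by simpa using hd 1
  rw [hC.mk_eq_link d hd (hC.segment_subset hx hy), hC.develop_trans_link f c hx hy hw]

lemma develop_self (f : Multi p) {x : Curve S} (c : Path.Homotopic.Quotient p x) :
    develop f c x.1 = f x c := by
  obtain ⟨C, hC, hx⟩ := exists_isCell_mem x
  rw [hC.develop_eq_path f c (Path.refl x) fun _ => hx, Path.Homotopic.Quotient.mk_refl,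
    Path.Homotopic.Quotient.trans_refl]

lemma develop_cont (σ : FundamentalGroup (Curve S) p) (f : Multi p) {x : Curve S}
    (c : Path.Homotopic.Quotient p x) (w : ℂ) :
    develop (f.cont σ) c w = develop f (σ.toPath.trans c) w := by
  unfold develop Multi.cont
  split_ifs
  · rw [Path.Homotopic.Quotient.trans_assoc]
  · rfl

/-- Near `w` the straight path from `x` may be replaced by the one through `w`, so the development
agrees with the local branch `g` on a small ball. -/
lemma IsCell.hasDerivAt_develop {C : Set ℂ} (hC : IsCell S C) {f f' : Multi p}
    (hf : HasMultiDeriv f f') {x : Curve S} (c : Path.Homotopic.Quotient p x) (hx : x.1 ∈ C)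
    {w : ℂ} (hw : w ∈ C) : HasDerivAt (develop f c) (develop f' c w) w := by
  lift w to Curve S using hC.subset hw
  obtain ⟨g, ⟨V, hV, hwV, hg⟩, hg'⟩ := hf w (c.trans (link x w (hC.segment_subset hx hw)))
  rw [hC.develop_eq f' c hx hw]
  refine hg'.congr_of_eventuallyEq ?_
  obtain ⟨V', hV', rfl⟩ := isOpen_induced_iff.mp hV
  obtain ⟨r, hr, hsub⟩ := Metric.isOpen_iff.mp (hV'.inter hC.isOpen) w.1 ⟨hwV, hw⟩
  filter_upwards [Metric.ball_mem_nhds w.1 hr] with y hy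
  have hyC := (hsub hy).2
  lift y to Curve S using hC.subset hyC
  have hB : IsCell S (Metric.ball w.1 r) :=
    ⟨Metric.isOpen_ball, convex_ball _ _, fun z hz => hC.subset (hsub hz).2⟩
  rw [← hC.develop_trans_link f c hx hw hyC, hC.develop_eq f _ hw hyC]
  exact hg y _ fun t => (hsub (hB.convex.lineMap_mem (Metric.mem_ball_self hr) hy t.2)).1

/-! ### Products, and the function `t^s` -/

lemma HasMultiDeriv.mul {f f' g g' : Multi p} (hf : HasMultiDeriv f f')
    (hg : HasMultiDeriv g g') : HasMultiDeriv (f * g) (f' * g + f * g') := by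
  intro z c
  obtain ⟨u, ⟨V, hV, hzV, hu⟩, hu'⟩ := hf z c
  obtain ⟨v, ⟨W, hW, hzW, hv⟩, hv'⟩ := hg z c
  refine ⟨u * v, ⟨V ∩ W, hV.inter hW, ⟨hzV, hzW⟩, fun w d hd => by
    simp [hu w d fun x => (hd x).1, hv w d fun x => (hd x).2]⟩, ?_⟩
  have h1 := hu z (Path.refl z) fun _ => hzV
  have h2 := hv z (Path.refl z) fun _ => hzW
  rw [Path.Homotopic.Quotient.mk_refl, Path.Homotopic.Quotient.trans_refl] at h1 h2
  simpa [h1, h2] using hu'.mul hv'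

lemma hasMultiDeriv_mlog (l : LogBranch p) : HasMultiDeriv (mlog l) (fun z _ => z.1⁻¹) := by
  intro z c
  have hz : z.1 ≠ 0 := z.2.1
  have hslit : ∀ w ∈ Metric.ball z.1 ‖z.1‖, w / z.1 ∈ Complex.slitPlane := by
    intro w hw
    refine Complex.mem_slitPlane_of_norm_lt_one (z := w / z.1 - 1) ?_ |> fun h => by simpa using h
    rw [div_sub_one hz, norm_div, div_lt_one (norm_pos_iff.mpr hz)]
    simpa [dist_eq_norm] using hw
  refine ⟨fun w => mlog l z c + Complex.log (w / z.1),
    ⟨{w | w.1 ∈ Metric.ball z.1 ‖z.1‖}, Metric.isOpen_ball.preimage continuous_subtype_val,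
      by simpa using hz, fun w d hd => ?_⟩, ?_⟩
  -- An explicit lift of `d` through `exp`: on the ball of radius `‖z‖` the quotient by `z` avoids
  -- the cut of the principal logarithm. Uniqueness of lifts identifies its endpoint with `mlog`.
  · let Γ : Path (mlog l z c) (mlog l z c + Complex.log (w.1 / z.1)) :=
      { toFun := fun t => mlog l z c + Complex.log ((d t).1 / z.1)
        continuous_toFun := by
          refine continuous_const.add (Continuous.clog ?_ fun t => hslit _ (hd t))
          fun_prop
        source' := by simp [hz]
        target' := by simp }
    have hc : (c.trans (.mk d)).map (toGm S) =
        (c.map (toGm S)).trans ((Path.Homotopic.Quotient.mk d).map (toGm S)) :=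
      (FundamentalGroupoid.map (toGm S)).map_comp (X := .mk p) (Y := .mk z) (Z := .mk w) c (.mk d)
    have hexp : ∀ t, Complex.exp (Γ t) = (d t).1 := fun t => by
      change Complex.exp (mlog l z c + Complex.log ((d t).1 / z.1)) = _
      rw [Complex.exp_add, exp_mlog, Complex.exp_log (div_ne_zero (d t).2.1 hz),
        mul_div_cancel₀ _ hz]
    have h := Complex.isCoveringMap_exp.monodromy_eq_of_map_eq
      (γ := (Path.Homotopic.Quotient.mk d).map (toGm S))
      (ex := ⟨mlog l z c, Subtype.ext (exp_mlog l z c)⟩)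
      (ey := ⟨mlog l z c + Complex.log (w.1 / z.1), Subtype.ext (show _ = w.1 by simpa using hexp 1)⟩)
      (.mk Γ) (by
        refine congrArg Path.Homotopic.Quotient.mk ?_
        ext t
        exact hexp t)
    simp only [mlog] at h ⊢
    rw [hc, IsCoveringMap.monodromy_trans_apply]
    exact congrArg Subtype.val h
  · have h1 : HasDerivAt (fun w : ℂ => w / z.1) (1 / z.1) z.1 := (hasDerivAt_id z.1).div_const z.1
    have h2 := (h1.clog (hslit _ (by simpa using hz))).const_add (mlog l z c)
    simpa [hz] using h2

lemma hasMultiDeriv_tpow (l : LogBranch p) (s : ℂ) :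
    HasMultiDeriv (tpow l s) (fun z c => tpow l s z c * (s * z.1⁻¹)) := by
  intro z c
  obtain ⟨u, ⟨V, hV, hzV, hu⟩, hu'⟩ := hasMultiDeriv_mlog l z c
  refine ⟨fun w => Complex.exp (s * u w), ⟨V, hV, hzV, fun w d hd => by
    simp only [tpow]; rw [hu w d hd]⟩, ?_⟩
  have h1 := hu z (Path.refl z) fun _ => hzV
  rw [Path.Homotopic.Quotient.mk_refl, Path.Homotopic.Quotient.trans_refl] at h1
  simpa [tpow, h1] using (hu'.const_mul s).cexp

lemma tpow_cont (l : LogBranch p) (s : ℂ) (σ : FundamentalGroup (Curve S) p) :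
    (tpow l (s - 1)).cont σ = e (winding l σ) s • tpow l (s - 1) := by
  funext z c
  have h := winding_spec l σ z c
  simp only [Multi.cont] at h
  simp only [Multi.cont, tpow, h, Pi.smul_apply, smul_eq_mul, e, ← Complex.exp_add]
  -- The exponent `s - 1` instead of `s` costs a factor `e^{-2πi n(σ)} = 1`.
  rw [Complex.exp_eq_exp_iff_exists_int]
  exact ⟨-winding l σ, by push_cast; ring⟩

end Development

/-! ### Propagation along paths -/

section Propagation

variable {S : Finset ℂ} {p z : Curve S}

/-- The transfer hypothesis is symmetric in `t` and `t'`, so `P` is locally constant on the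
connected interval; no subdivision has to be chosen. -/
lemma path_propagate {𝒞 : Set (Set ℂ)} (h𝒞 : ∀ x : Curve S, ∃ C ∈ 𝒞, IsOpen C ∧ x.1 ∈ C)
    (γ : Path p z) (P : unitInterval → Prop)
    (h : ∀ t t', ∀ C ∈ 𝒞, (∀ u ∈ Set.uIcc t t', (γ u).1 ∈ C) → P t → P t')
    (h0 : P 0) : P 1 := by
  have hP : IsLocallyConstant P := by
    rw [IsLocallyConstant.iff_eventually_eq]
    intro t
    obtain ⟨C, hC, hCo, htC⟩ := h𝒞 (γ t)
    have hnhds : {u | (γ u).1 ∈ C} ∈ nhds t :=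
      (hCo.preimage (continuous_subtype_val.comp γ.continuous)).mem_nhds htC
    have hlim : Filter.Tendsto (fun t' => Set.uIcc t t') (nhds t) (nhds t).smallSets :=
      tendsto_const_nhds.uIcc Filter.tendsto_id
    filter_upwards [Filter.tendsto_smallSets_iff.mp hlim _ hnhds] with t' ht'
    exact propext ⟨h t' t C hC fun u hu => ht' (by rwa [Set.uIcc_comm]),
      h t t' C hC fun u hu => ht' hu⟩
  exact (hP.apply_eq_of_preconnectedSpace 0 1).mp h0

/-- The homotopy class of the initial piece `γ|_[0,t]`. -/
def initial (γ : Path p z) (t : unitInterval) : Path.Homotopic.Quotient p (γ t) :=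
  .mk ((γ.subpath 0 t).cast γ.source.symm rfl)

lemma initial_trans (γ : Path p z) (t t' : unitInterval) :
    (initial γ t).trans (.mk (γ.subpath t t')) = initial γ t' := by
  have h : ∀ {x y w : Curve S} (d : Path x y) (d' : Path y w) (h : p = x),
      (Path.Homotopic.Quotient.mk (d.cast h rfl)).trans (.mk d') =
        (Path.Homotopic.Quotient.mk (d.trans d')).cast h rfl := by
    rintro x y w d d' rfl
    rfl
  rw [initial, h, Path.Homotopic.Quotient.eq.mpr ⟨Path.Homotopy.subpathTransSubpath γ 0 t t'⟩]
  rfl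

/-- Needed because `γ 0` and `γ 1` are the endpoints of `γ` only propositionally. -/
lemma apply_cast (f : Multi p) {x y : Curve S} (c : Path.Homotopic.Quotient p x) (h : y = x) :
    f y (c.cast rfl h) = f x c := by
  subst h
  rw [Path.Homotopic.Quotient.cast_rfl_rfl]

lemma apply_initial_one (f : Multi p) (γ : Path p z) :
    f (γ 1) (initial γ 1) = f z (.mk γ) := by
  rw [← apply_cast f (.mk γ) γ.target, initial, Path.subpath_zero_one]
  rfl

lemma apply_initial_zero (f : Multi p) (γ : Path p z) :
    f (γ 0) (initial γ 0) = f p (.refl p) := by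
  rw [← apply_cast f (.refl p) γ.source, initial, Path.subpath_self]
  congr 1
  have : ∀ {x : Curve S} (h : p = x) , Path.Homotopic.Quotient.mk ((Path.refl x).cast h rfl) =
      (Path.Homotopic.Quotient.refl p).cast rfl h.symm := by
    rintro x rfl; rfl
  exact this _

end Propagation

/-! ### Solutions form a finite-dimensional space -/

section Finiteness

variable {S : Finset ℂ}

lemma evalAt_mul_discr (a : Reg S) :
    ∃ (q : Polynomial ℂ) (n : ℕ), ∀ z : Curve S,
      evalAt z a = q.eval z.1 / ((discr S).eval z.1) ^ n := by
  obtain ⟨⟨q, ⟨_, n, rfl⟩⟩, hq⟩ := IsLocalization.surj (Submonoid.powers (discr S)) a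
  refine ⟨q, n, fun z => ?_⟩
  have h := congrArg (evalAt z) hq
  have hl : ∀ r : Polynomial ℂ, evalAt z (algebraMap _ (Reg S) r) = r.eval z.1 := fun r =>
    IsLocalization.Away.lift_eq _ (isUnit_eval_discr S z) r
  simp only [map_mul, hl, Polynomial.eval_pow] at h
  exact eq_div_of_mul_eq (pow_ne_zero n (isUnit_eval_discr S z).ne_zero) h

lemma continuous_evalAt (a : Reg S) : Continuous fun z : Curve S => evalAt z a := by
  obtain ⟨q, n, h⟩ := evalAt_mul_discr a
  simp only [h]
  refine Continuous.div (by fun_prop) (by fun_prop) fun z =>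
    pow_ne_zero n (isUnit_eval_discr S z).ne_zero

variable {M : Type} [AddCommGroup M] [Module (Reg S) M] {D : AlgConnection S M} {p : Curve S}

/-- The value of `⟨m, ε⟩` at a point of the universal cover is additive in `m`. -/
def Sol.value (ε : Sol D p) (z : Curve S) (c : Path.Homotopic.Quotient p z) : M →+ ℂ :=
  AddMonoidHom.mk' (fun m => ε.1 m z c) fun m m' => congrFun (congrFun (ε.2.1 m m') z) c

lemma Sol.value_smul (ε : Sol D p) (z : Curve S) (c : Path.Homotopic.Quotient p z) (a : Reg S)
    (m : M) : Sol.value ε z c (a • m) = evalAt z a * Sol.value ε z c m :=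
  ε.2.2.1 a m z c

lemma hasMultiDeriv_pair (m : M) (ε : Sol D p) :
    HasMultiDeriv (pair m ε) (pair (D.ddt m) ε) := ε.2.2.2 m

lemma Sol.value_eq_zero_of_span {ι : Type*} [Fintype ι] {b : ι → M}
    (hb : Submodule.span (Reg S) (Set.range b) = ⊤) (ε : Sol D p) (z : Curve S)
    (c : Path.Homotopic.Quotient p z) (h : ∀ j, Sol.value ε z c (b j) = 0) (m : M) :
    Sol.value ε z c m = 0 := by
  obtain ⟨a, rfl⟩ := (Submodule.mem_span_range_iff_exists_fun (Reg S)).mp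
    (hb ▸ Submodule.mem_top : m ∈ Submodule.span (Reg S) (Set.range b))
  simp [map_sum, Sol.value_smul, h]

/-- Along the segment, the values on generators `b j` satisfy a linear differential equation, since
each `D.ddt (b j)` is a combination of the `b k`. Its coefficients are bounded, so Grönwall's
inequality forces zero initial data to stay zero. The generators need not be independent. -/
lemma Sol.value_eq_zero_of_isCell [Module.Finite (Reg S) M] (ε : Sol D p) {C : Set ℂ}
    (hC : IsCell S C) {x y : Curve S} (hx : x.1 ∈ C) (hy : y.1 ∈ C)
    (c : Path.Homotopic.Quotient p x) (h : ∀ m, Sol.value ε x c m = 0) (m : M) :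
    Sol.value ε y (c.trans (link x y (hC.segment_subset hx hy))) m = 0 := by
  obtain ⟨n, b, hb⟩ := Module.Finite.exists_fin (R := Reg S) (M := M)
  choose a ha using fun j => (Submodule.mem_span_range_iff_exists_fun (Reg S)).mp
    (hb ▸ Submodule.mem_top : D.ddt (b j) ∈ Submodule.span (Reg S) (Set.range b))
  let q : ℝ → ℂ := fun t => AffineMap.lineMap x.1 y.1 t
  have hq : ∀ t ∈ Set.Icc (0 : ℝ) 1, q t ∈ C := fun t ht => hC.convex.lineMap_mem hx hy ht
  let q' : unitInterval → Curve S := fun t => ⟨q t, hC.subset (hq t t.2)⟩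
  have hq' : Continuous q' :=
    Continuous.subtype_mk (AffineMap.lineMap_continuous.comp continuous_subtype_val) _
  let u : ℝ → Fin n → ℂ := fun t j => develop (pair (b j) ε) c (q t)
  let u' : ℝ → Fin n → ℂ := fun t j => develop (pair (D.ddt (b j)) ε) c (q t) * (y.1 - x.1)
  obtain ⟨B, hB⟩ := isCompact_univ.exists_bound_of_continuousOn
    (f := fun t => ∑ j, ∑ k, ‖evalAt (q' t) (a j k)‖)
    (continuous_finsetSum _ fun j _ => continuous_finsetSum _ fun k _ =>
      ((continuous_evalAt (a j k)).comp hq').norm).continuousOn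
  have hderiv : ∀ t ∈ Set.Icc (0 : ℝ) 1, HasDerivAt u (u' t) t := fun t ht => by
    refine hasDerivAt_pi.mpr fun j => ?_
    have h1 := hC.hasDerivAt_develop (hasMultiDeriv_pair (b j) ε) c hx (hq t ht)
    have h2 : HasDerivAt q (y.1 - x.1) t := by
      simpa using (AffineMap.lineMap x.1 y.1 : ℝ →ᵃ[ℝ] ℂ).hasDerivAt (x := t)
    exact HasDerivAt.comp t h1 h2
  have hu : ∀ t ∈ Set.Icc (0 : ℝ) 1, u t = 0 := by
    refine eq_zero_of_abs_deriv_le_mul_abs_self_of_eq_zero_right (f' := u') (K := B * ‖y.1 - x.1‖)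
      (fun t ht => (hderiv t ht).continuousAt.continuousWithinAt)
      (fun t ht => (hderiv t (Set.Ico_subset_Icc_self ht)).hasDerivWithinAt) ?_ fun t ht => ?_
    · funext j
      simp only [u, q, AffineMap.lineMap_apply_zero, develop_self]
      exact h (b j)
    · have ht' := Set.Ico_subset_Icc_self ht
      have hB' := hB ⟨t, ht'⟩ trivial
      rw [Real.norm_of_nonneg (by positivity)] at hB'
      have hB0 : 0 ≤ B := le_trans (by positivity) hB'
      refine (pi_norm_le_iff_of_nonneg (by positivity)).mpr fun j => ?_
      have hdev : ∀ m', develop (pair m' ε) c (q t) =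
          Sol.value ε (q' ⟨t, ht'⟩) (c.trans (link x _ (hC.segment_subset hx (hq t ht')))) m' :=
        fun m' => hC.develop_eq (w := q' ⟨t, ht'⟩) _ c hx (hq t ht')
      have hj : u' t j = (∑ k, evalAt (q' ⟨t, ht'⟩) (a j k) * u t k) * (y.1 - x.1) := by
        simp only [u', u, hdev, ← ha j, map_sum, Sol.value_smul]
      rw [hj, norm_mul, mul_right_comm]
      refine mul_le_mul_of_nonneg_right ?_ (norm_nonneg _)
      calc ‖∑ k, evalAt (q' ⟨t, ht'⟩) (a j k) * u t k‖
          ≤ ∑ k, ‖evalAt (q' ⟨t, ht'⟩) (a j k)‖ * ‖u t‖ :=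
            norm_sum_le_of_le _ fun k _ => by
              rw [norm_mul]; gcongr; exact norm_le_pi_norm _ k
        _ = (∑ k, ‖evalAt (q' ⟨t, ht'⟩) (a j k)‖) * ‖u t‖ := by rw [Finset.sum_mul]
        _ ≤ B * ‖u t‖ := by
            gcongr
            refine le_trans ?_ hB'
            exact Finset.single_le_sum (f := fun j => ∑ k, ‖evalAt (q' ⟨t, ht'⟩) (a j k)‖)
              (fun _ _ => by positivity) (Finset.mem_univ j)
  refine Sol.value_eq_zero_of_span hb ε y _ (fun j => ?_) m
  have := congrFun (hu 1 (by simp)) j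
  simp only [u, q, AffineMap.lineMap_apply_one] at this
  rwa [hC.develop_eq _ c hx hy] at this

/-- Vanishing spreads cell by cell along any path, so initial values at `p` determine a solution. -/
lemma Sol.eq_zero [Module.Finite (Reg S) M] (ε : Sol D p)
    (h : ∀ m, Sol.value ε p (.refl p) m = 0) : ε = 0 := by
  refine Subtype.ext (funext fun m => funext fun z => funext fun c => ?_)
  induction c with | mk γ =>
  have h1 := path_propagate (𝒞 := {C | IsCell S C})
    (fun x => (exists_isCell_mem x).imp fun C hC => ⟨hC.1, hC.1.isOpen, hC.2⟩) γ (fun t => ∀ m, Sol.value ε (γ t) (initial γ t) m = 0)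
    (fun t t' C hC hmem ht m => ?_) fun m => ?_
  · exact (apply_initial_one (ε.1 m) γ).symm.trans (h1 m)
  · have hx := hmem t Set.left_mem_uIcc
    have hy := hmem t' Set.right_mem_uIcc
    rw [← initial_trans γ t t', hC.mk_eq_link _ (fun u => ?_) (hC.segment_subset hx hy)]
    · exact Sol.value_eq_zero_of_isCell ε hC hx hy _ ht m
    · obtain ⟨v, hv, hv'⟩ := (Path.range_subpath γ t t').le ⟨u, rfl⟩
      exact hv' ▸ hmem v hv
  · exact (apply_initial_zero (ε.1 m) γ).trans (h m)

lemma finite_sol [Module.Finite (Reg S) M] : Module.Finite ℂ (Sol D p) := by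
  obtain ⟨n, b, hb⟩ := Module.Finite.exists_fin (R := Reg S) (M := M)
  let f : Sol D p →ₗ[ℂ] Fin n → ℂ :=
    { toFun := fun ε j => ε.1 (b j) p (.refl p)
      map_add' := fun _ _ => rfl
      map_smul' := fun _ _ => rfl }
  refine Module.Finite.of_injective f ((injective_iff_map_eq_zero f).mpr fun ε hε => ?_)
  exact Sol.eq_zero ε (Sol.value_eq_zero_of_span hb ε p _ fun j => congrFun hε j)

lemma KStructure.finite [Module.Finite (Reg S) M] {K : Subfield ℂ} (𝓛 : KStructure K D p) :
    Module.Finite K 𝓛.L := by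
  have := finite_sol (D := D) (p := p)
  have : Module.Finite ℂ (ℂ ⊗[K] 𝓛.L) := Module.Finite.equiv 𝓛.isBaseChange.equiv.symm
  exact Module.Finite.of_finite_tensorProduct_of_faithfullyFlat (R := K) (M := 𝓛.L) ℂ

end Finiteness

/-! ### A finite cover of `U` by convex cells -/

/-- The intersection of half planes not containing the punctures, one for every puncture `a`;
`φ a` gives its direction. -/
def cell (S : Finset ℂ) (φ : (insert 0 S : Finset ℂ) → Fin 4) : Set ℂ :=
  ⋂ a, {z | (Complex.I ^ (φ a : ℕ) * a.1).re < (Complex.I ^ (φ a : ℕ) * z).re}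

lemma isCell_cell (S : Finset ℂ) (φ : (insert 0 S : Finset ℂ) → Fin 4) : IsCell S (cell S φ) where
  isOpen := isOpen_iInter_of_finite fun a => isOpen_lt (by fun_prop) (by fun_prop)
  convex := convex_iInter fun a => convex_halfSpace_gt
    ⟨fun x y => by rw [mul_add, Complex.add_re], fun c x => by
      rw [Complex.real_smul, mul_left_comm, Complex.re_ofReal_mul, smul_eq_mul]⟩ _
  subset := fun z hz => by
    have h : ∀ a ∈ insert 0 S, z ≠ a := by
      rintro a ha rfl
      exact lt_irrefl (Complex.I ^ (φ ⟨z, ha⟩ : ℕ) * z).re (Set.mem_iInter.mp hz ⟨z, ha⟩)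
    exact ⟨h 0 (Finset.mem_insert_self _ _), fun hS => h z (Finset.mem_insert_of_mem hS) rfl⟩

lemma exists_mem_cell {S : Finset ℂ} {z : ℂ} (hz : z ∈ domain S) : ∃ φ, z ∈ cell S φ := by
  have h : ∀ a : (insert 0 S : Finset ℂ), ∃ k : Fin 4,
      (Complex.I ^ (k : ℕ) * a.1).re < (Complex.I ^ (k : ℕ) * z).re := by
    rintro ⟨a, ha⟩
    have hne : z ≠ a := by
      rintro rfl
      exact (Finset.mem_insert.mp ha).elim hz.1 hz.2
    by_contra! hcon
    -- The real parts of `I ^ k * z` are `re z`, `-im z`, `-re z`, `im z`; if all four inequalities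
    -- fail then `z = a`.
    have h0 := hcon 0
    have h1 := hcon 1
    have h2 := hcon 2
    have h3 := hcon 3
    simp [pow_succ] at h0 h1 h2 h3
    exact hne (Complex.ext (le_antisymm h0 h2) (le_antisymm h3 h1))
  choose φ hφ using h
  exact ⟨φ, Set.mem_iInter.mpr hφ⟩

lemma IsCell.exists_primitive {S : Finset ℂ} {C : Set ℂ} (hC : IsCell S C) {p x : Curve S}
    {f f' : Multi p} (hf : HasMultiDeriv f f') (c : Path.Homotopic.Quotient p x) (hx : x.1 ∈ C) :
    ∃ H : ℂ → ℂ, ∀ w ∈ C, HasDerivAt H (develop f c w) w := by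
  obtain ⟨H, hH⟩ := hC.convex.exists_forall_hasDerivWithinAt (𝕜 := ℂ) (f := develop f c)
    fun w hw => (hC.hasDerivAt_develop hf c hx hw).differentiableAt.differentiableWithinAt
  exact ⟨H, fun w hw => (hH w hw).hasDerivAt (hC.isOpen.mem_nhds hw)⟩

lemma IsCell.primitive_sub_eq {S : Finset ℂ} {C : Set ℂ} (hC : IsCell S C) {G H H' : ℂ → ℂ}
    (hH : ∀ w ∈ C, HasDerivAt H (G w) w) (hH' : ∀ w ∈ C, HasDerivAt H' (G w) w) {x y : ℂ}
    (hx : x ∈ C) (hy : y ∈ C) : H x - H' x = H y - H' y := by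
  refine hC.convex.is_const_of_fderivWithin_eq_zero (𝕜 := ℂ) (f := fun w => H w - H' w)
    (fun w hw => ((hH w hw).sub (hH' w hw)).differentiableAt.differentiableWithinAt)
    (fun w hw => ?_) hx hy
  rw [fderivWithin_of_isOpen hC.isOpen hw]
  have h := (hH w hw).fun_sub (hH' w hw)
  rw [sub_self] at h
  rw [h.hasFDerivAt.fderiv]
  ext
  simp

/-! ### The module of values of primitives -/

section Primitives

variable {S : Finset ℂ} {M : Type} [AddCommGroup M] [Module (Reg S) M]
  {K : Subfield ℂ} {D : AlgConnection S M} {p : Curve S}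

instance KStructure.instModule (𝓛 : KStructure K D p) : Module K 𝓛.L := Submodule.module 𝓛.L

instance KStructure.instSMul (𝓛 : KStructure K D p) : SMul K 𝓛.L :=
  (Submodule.module 𝓛.L).toSMul

instance KStructure.instFree (𝓛 : KStructure K D p) : Module.Free K 𝓛.L :=
  Module.Free.of_divisionRing K 𝓛.L

/-- The multivalued function `⟨m, ε⟩ t^{s-1}`. -/
def integrand {𝓛 : KStructure K D p} (l : LogBranch p) (m : M) (ε : 𝓛.L) (s : ℂ) : Multi p :=
  pair m ε.1 * tpow l (s - 1)

variable (𝓛 : KStructure K D p) (l : LogBranch p) (m : M)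

lemma exists_hasMultiDeriv_integrand (ε : 𝓛.L) (s : ℂ) :
    ∃ f', HasMultiDeriv (integrand l m ε s) f' :=
  ⟨_, (hasMultiDeriv_pair m ε.1).mul (hasMultiDeriv_tpow l (s - 1))⟩

lemma integrand_cont (ε : 𝓛.L) (s : ℂ) (σ : FundamentalGroup (Curve S) p) :
    (integrand l m ε s).cont σ =
      e (winding l σ) s • integrand l m (𝓛.monodromy σ ε) s := by
  have h : (integrand l m ε s).cont σ =
      pair m (𝓛.monodromy σ ε).1 * (tpow l (s - 1)).cont σ := rfl
  rw [h, tpow_cont, mul_smul_comm]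
  rfl

lemma integrand_sum {κ : Type*} (t : Finset κ) (a : κ → K) (ε : κ → 𝓛.L) (s : ℂ) :
    integrand l m (∑ k ∈ t, a k • ε k) s = ∑ k ∈ t, (a k : ℂ) • integrand l m (ε k) s := by
  classical
  induction t using Finset.induction_on with
  | empty => funext z c; exact zero_mul _
  | insert k t hk ih =>
    rw [Finset.sum_insert hk, Finset.sum_insert hk, ← ih]
    funext z c
    simp only [integrand, Pi.mul_apply, Pi.add_apply, Pi.smul_apply, smul_eq_mul, ← mul_assoc]
    exact add_mul _ _ _

lemma develop_sum {κ : Type*} (t : Finset κ) (a : κ → ℂ) (f : κ → Multi p) {x : Curve S}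
    (c : Path.Homotopic.Quotient p x) (w : ℂ) :
    develop (∑ k ∈ t, a k • f k) c w = ∑ k ∈ t, a k * develop (f k) c w := by
  unfold develop
  split_ifs
  · simp [Finset.sum_apply]
  · simp

variable {𝓛}

/-- The two classes differ by a loop `σ`. Continuing the integrand along `σ` replaces `ε` by `σ ε`
and multiplies by `e^{2πi s n(σ)}`; it remains to expand `σ ε` in the basis. -/
lemma IsCell.exists_develop_integrand_eq {C : Set ℂ} (hC : IsCell S C) {κ : Type*} [Fintype κ]
    (b : Module.Basis κ K 𝓛.L) {x y : Curve S} (hx : x.1 ∈ C) (hy : y.1 ∈ C)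
    (c : Path.Homotopic.Quotient p x) (c' : Path.Homotopic.Quotient p y) (ε : 𝓛.L) :
    ∃ r : κ → R K, ∀ s, ∀ w ∈ C, develop (integrand l m ε s) c w =
      ∑ k, (r k).1 s * develop (integrand l m (b k) s) c' w := by
  let d := c.trans (link x y (hC.segment_subset hx hy))
  let σ : FundamentalGroup (Curve S) p := FundamentalGroup.fromPath (d.trans c'.symm)
  have hσ : σ.toPath.trans c' = d := by
    change (d.trans c'.symm).trans c' = d
    rw [Path.Homotopic.Quotient.trans_assoc, Path.Homotopic.Quotient.symm_trans,
      Path.Homotopic.Quotient.trans_refl]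
  refine ⟨fun k => b.repr (𝓛.monodromy σ ε) k • eR K (winding l σ), fun s w hw => ?_⟩
  rw [← hC.develop_trans_link _ c hx hy hw]
  change develop _ d w = _
  rw [← hσ, ← develop_cont, integrand_cont]
  conv_lhs => rw [← b.sum_repr (𝓛.monodromy σ ε), integrand_sum, Finset.smul_sum]
  simp only [smul_smul]
  rw [develop_sum]
  refine Finset.sum_congr rfl fun k _ => ?_
  congr 1
  exact mul_comm _ _

/-- The point is uniformity: `W` is chosen before `x`, `c` and `ε`. -/
lemma IsCell.exists_primitive_module {C : Set ℂ} (hC : IsCell S C) [Module.Finite K 𝓛.L]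
    {B : Set ℂ} (hB : B.Finite) :
    ∃ W : Submodule (R K) (ℂ → ℂ), W.FG ∧
      ∀ (x : Curve S) (_ : x.1 ∈ C) (c : Path.Homotopic.Quotient p x) (ε : 𝓛.L),
        ∃ H : ℂ → ℂ → ℂ,
          (∀ s, ∀ w ∈ C, HasDerivAt (H s) (develop (integrand l m ε s) c w) w) ∧
          ∀ z ∈ B, (fun s => H s z) ∈ W := by
  by_cases hne : ∃ y : Curve S, y.1 ∈ C ∧ Nonempty (Path.Homotopic.Quotient p y)
  swap
  -- A cell that no path from `p` reaches imposes no condition.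
  · exact ⟨⊥, Submodule.fg_bot, fun x hx c => (hne ⟨x, hx, ⟨c⟩⟩).elim⟩
  obtain ⟨y, hy, ⟨c'⟩⟩ := hne
  let b := Module.finBasis K 𝓛.L
  choose f' hf' using exists_hasMultiDeriv_integrand 𝓛 l m
  choose P hP using fun k s => hC.exists_primitive (hf' (b k) s) c' hy
  have := hB.to_subtype
  refine ⟨Submodule.span (R K) (Set.range fun q : _ × B => fun s => P q.1 s q.2.1),
    Submodule.fg_span (Set.finite_range _), fun x hx c ε => ?_⟩
  obtain ⟨r, hr⟩ := hC.exists_develop_integrand_eq l m b hx hy c c' ε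
  refine ⟨fun s w => ∑ k, (r k).1 s * P k s w, fun s w hw => ?_, fun z hz => ?_⟩
  · rw [hr s w hw]
    exact HasDerivAt.fun_sum fun k _ => (hP k s w hw).const_mul _
  · have h : (fun s => ∑ k, (r k).1 s * P k s z) = ∑ k, r k • fun s => P k s z := by
      funext s
      rw [Finset.sum_apply]
      rfl
    rw [h]
    exact Submodule.sum_mem _ fun k _ =>
      Submodule.smul_mem _ _ (Submodule.subset_span ⟨(k, ⟨z, hz⟩), rfl⟩)

end Primitives

/-! ### Integration along piecewise `C¹` paths -/

section Integration

variable {S : Finset ℂ} {p : Curve S}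

/-- The function integrated in `loopIntegral`. -/
def pulledBack (f : Multi p) (γ : Path p p) (x : ℝ) : ℂ :=
  f (γ (Set.projIcc 0 1 zero_le_one x)) (initial γ (Set.projIcc 0 1 zero_le_one x)) *
    deriv (fun y => (γ.extend y : ℂ)) x

lemma loopIntegral_eq (f : Multi p) (γ : Path p p) :
    loopIntegral f γ = ∫ x in (0 : ℝ)..1, pulledBack f γ x := rfl

lemma PiecewiseC1.exists_finite {γ : Path p p} (h : PiecewiseC1 γ) :
    ∃ s : Set ℝ, s.Finite ∧ ∀ x ∈ Set.Ioo (0 : ℝ) 1 \ s,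
      DifferentiableAt ℝ (fun y => (γ.extend y : ℂ)) x := by
  obtain ⟨n, a, ha, h0, h1, hC⟩ := h
  refine ⟨a '' Set.Iic n, (Set.finite_Iic n).image a, fun x ⟨hx, hxs⟩ => ?_⟩
  classical
  -- The first subdivision point beyond `x` is the right end of the piece containing `x`.
  have hex : ∃ k, x < a k := ⟨n, h1 ▸ hx.2⟩
  have hk := Nat.find_spec hex
  have hkn : Nat.find hex ≤ n := Nat.find_le_iff _ _ |>.mpr ⟨n, le_rfl, h1 ▸ hx.2⟩
  obtain ⟨i, hi⟩ : ∃ i, Nat.find hex = i + 1 := Nat.exists_eq_succ_of_ne_zero fun h => by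
    rw [h, h0] at hk
    exact hk.not_gt hx.1
  rw [hi] at hk hkn
  have hi' : a i ≤ x := not_lt.mp (Nat.find_min hex (by omega))
  have hne : a i ≠ x := fun h => hxs ⟨i, by simp; omega, h⟩
  exact ((hC i (by omega)).differentiableOn one_ne_zero).differentiableAt
    (Icc_mem_nhds (lt_of_le_of_ne hi' hne) hk)

lemma PiecewiseC1.intervalIntegrable_deriv {γ : Path p p} (h : PiecewiseC1 γ) :
    IntervalIntegrable (deriv fun y => (γ.extend y : ℂ)) MeasureTheory.volume 0 1 := by
  obtain ⟨n, a, ha, h0, h1, hC⟩ := h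
  rw [← h0, ← h1]
  refine IntervalIntegrable.trans_iterate fun i hi => ?_
  rcases (ha (Nat.le_succ i)).eq_or_lt with heq | hlt
  · rw [← Nat.succ_eq_add_one, heq]
  · have hc := (hC i hi).continuousOn_derivWithin (uniqueDiffOn_Icc hlt) le_rfl
    rw [← Set.uIcc_of_le hlt.le] at hc
    refine hc.intervalIntegrable.congr_uIoo fun x hx => ?_
    rw [Set.uIoo_of_le hlt.le] at hx
    rw [Set.uIcc_of_le hlt.le]
    exact derivWithin_of_mem_nhds (Icc_mem_nhds hx.1 hx.2)

/-- The integrand is the derivative of the continuous function `H ∘ γ` off a finite set. Both orders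
of `t` and `t'` are allowed, as `path_propagate` requires. -/
lemma IsCell.integral_pulledBack {C : Set ℂ} (hC : IsCell S C) {f f' : Multi p}
    (hf : HasMultiDeriv f f') {γ : Path p p} (hγ : PiecewiseC1 γ) {t t' : unitInterval}
    (hmem : ∀ u ∈ Set.uIcc t t', (γ u).1 ∈ C) {H : ℂ → ℂ}
    (hH : ∀ w ∈ C, HasDerivAt H (develop f (initial γ t) w) w) :
    IntervalIntegrable (pulledBack f γ) MeasureTheory.volume t t' ∧
      ∫ x in (t : ℝ)..t', pulledBack f γ x = H (γ t').1 - H (γ t).1 := by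
  have hsub : Set.uIcc (t : ℝ) t' ⊆ Set.Icc 0 1 := Set.uIcc_subset_Icc t.2 t'.2
  have hext : ∀ x ∈ Set.uIcc (t : ℝ) t', (γ.extend x).1 ∈ C ∧
      pulledBack f γ x = develop f (initial γ t) (γ.extend x).1 *
        deriv (fun y => (γ.extend y : ℂ)) x := fun x hx => by
    have hproj : Set.projIcc (0 : ℝ) 1 zero_le_one x = ⟨x, hsub hx⟩ :=
      Set.projIcc_of_mem _ (hsub hx)
    have hu : (⟨x, hsub hx⟩ : unitInterval) ∈ Set.uIcc t t' := by
      rcases le_total t t' with h | h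
      · rw [Set.uIcc_of_le h]; rwa [Set.uIcc_of_le (Subtype.coe_le_coe.mpr h)] at hx
      · rw [Set.uIcc_of_ge h]; rwa [Set.uIcc_of_ge (Subtype.coe_le_coe.mpr h)] at hx
    rw [pulledBack, Path.extend_apply γ (hsub hx), hproj]
    refine ⟨hmem _ hu, ?_⟩
    rw [hC.develop_eq_path f _ (γ.subpath t ⟨x, hsub hx⟩) fun v => ?_, initial_trans]
    obtain ⟨v', hv', hv⟩ := (Path.range_subpath γ t ⟨x, hsub hx⟩).le ⟨v, rfl⟩
    exact hv ▸ hmem v' (Set.uIcc_subset_uIcc_left hu hv')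
  have hcont : Continuous fun y => (γ.extend y : ℂ) :=
    continuous_subtype_val.comp γ.continuous_extend
  have hx : (γ t).1 ∈ C := hmem t Set.left_mem_uIcc
  have hint : IntervalIntegrable (pulledBack f γ) MeasureTheory.volume t t' := by
    have h1 : ContinuousOn (fun x => develop f (initial γ t) (γ.extend x).1)
        (Set.uIcc (t : ℝ) t') := fun x hx' =>
      (ContinuousAt.comp (f := fun y => (γ.extend y : ℂ))
        (hC.hasDerivAt_develop hf (initial γ t) hx (hext x hx').1).continuousAt
        hcont.continuousAt).continuousWithinAt
    have h2 := hγ.intervalIntegrable_deriv.mono_set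
      (hsub.trans (Set.uIcc_of_le zero_le_one).ge)
    exact (h2.continuousOn_mul h1).congr fun x hx' => (hext x (Set.uIoc_subset_uIcc hx')).2.symm
  refine ⟨hint, ?_⟩
  obtain ⟨s, hs, hdiff⟩ := hγ.exists_finite
  rw [MeasureTheory.integral_eq_of_hasDerivAt_off_countable
    (fun x => H (γ.extend x).1) _ hs.countable (fun x hx' =>
      (ContinuousAt.comp (f := fun y => (γ.extend y : ℂ)) (hH _ (hext x hx').1).continuousAt
        hcont.continuousAt).continuousWithinAt) (fun x hx' => ?_) hint]
  · simp
  · have hx'' : x ∈ Set.uIcc (t : ℝ) t' := Set.Ioo_subset_Icc_self hx'.1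
    rw [(hext x hx'').2]
    refine HasDerivAt.comp x (hH _ (hext x hx'').1)
      (hdiff x ⟨⟨?_, ?_⟩, hx'.2⟩).hasDerivAt
    · exact lt_of_le_of_lt (le_min t.2.1 t'.2.1) hx'.1.1
    · exact lt_of_lt_of_le hx'.1.2 (max_le t.2.2 t'.2.2)

end Integration

/-! ### Loop integrals and the module of gamma functions -/

section Gamma

variable {S : Finset ℂ} {M : Type} [AddCommGroup M] [Module (Reg S) M]
  {K : Subfield ℂ} {D : AlgConnection S M} {p : Curve S}

/-- A single finitely generated module contains the integrals over all loops. -/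
lemma exists_fg_loopIntegral_mem (𝓛 : KStructure K D p) [Module.Finite K 𝓛.L] (l : LogBranch p)
    (m : M) :
    ∃ W : Submodule (R K) (ℂ → ℂ), W.FG ∧ ∀ (γ : Path p p) (_ : PiecewiseC1 γ) (ε : 𝓛.L),
      (fun s => loopIntegral (integrand l m ε s) γ) ∈ W := by
  classical
  -- One marked point per overlap; the default `0` for an empty overlap only adds superfluous
  -- generators.
  let b : ((insert 0 S : Finset ℂ) → Fin 4) × ((insert 0 S : Finset ℂ) → Fin 4) → ℂ := fun q =>
    if h : (cell S q.1 ∩ cell S q.2).Nonempty then h.some else 0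
  have hb : ∀ φ ψ, (cell S φ ∩ cell S ψ).Nonempty → b (φ, ψ) ∈ cell S φ ∩ cell S ψ :=
    fun φ ψ h => by
      have hbs : b (φ, ψ) = h.some := dif_pos h
      exact hbs ▸ h.some_mem
  let B : Set ℂ := insert p.1 (Set.range b)
  have hB : B.Finite := (Set.finite_range b).insert _
  choose Wc hWfg hW using fun φ => (isCell_cell S φ).exists_primitive_module (𝓛 := 𝓛) l m hB
  refine ⟨⨆ φ, Wc φ, Submodule.fg_iSup _ hWfg, fun γ hγ ε => ?_⟩
  have hle : ∀ φ, Wc φ ≤ ⨆ φ, Wc φ := le_iSup Wc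
  generalize (⨆ φ, Wc φ) = W at hle
  choose f' hf' using exists_hasMultiDeriv_integrand 𝓛 l m
  -- The invariant ranges over all cells containing `γ t` and all primitives normalized at the
  -- marked points, so that changing cells is part of the propagation step.
  have key := path_propagate (𝒞 := Set.range (cell S))
    (fun x => by
      obtain ⟨φ, hφ⟩ := exists_mem_cell x.2
      exact ⟨_, ⟨φ, rfl⟩, (isCell_cell S φ).isOpen, hφ⟩) γ
    (fun t => (∀ s, IntervalIntegrable (pulledBack (integrand l m ε s) γ)
        MeasureTheory.volume 0 t) ∧
      ∀ φ, (γ t).1 ∈ cell S φ → ∀ H : ℂ → ℂ → ℂ,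
        (∀ s, ∀ w ∈ cell S φ,
          HasDerivAt (H s) (develop (integrand l m ε s) (initial γ t) w) w) →
        (∀ z ∈ B, (fun s => H s z) ∈ W) →
        (fun s => (∫ x in (0 : ℝ)..t, pulledBack (integrand l m ε s) γ x) - H s (γ t)) ∈ W)
    ?_ ?_
  · obtain ⟨φ, hφ⟩ := exists_mem_cell (γ 1).2
    obtain ⟨H, hH, hHB⟩ := hW φ (γ 1) hφ (initial γ 1) ε
    have hp := hle φ (hHB p.1 (Set.mem_insert _ _))
    have h1 := key.2 φ hφ H hH fun z hz => hle φ (hHB z hz)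
    convert W.add_mem h1 hp using 1
    funext s
    simp [loopIntegral_eq]
  · rintro t t' _ ⟨φ, rfl⟩ hmem ⟨hint, hP⟩
    have hφ := hmem t Set.left_mem_uIcc
    have hφ' := hmem t' Set.right_mem_uIcc
    obtain ⟨H, hH, hHB⟩ := hW φ (γ t) hφ (initial γ t) ε
    have hFTC := fun s => (isCell_cell S φ).integral_pulledBack (hf' ε s) hγ hmem (hH s)
    refine ⟨fun s => (hint s).trans (hFTC s).1, fun ψ hψ H' hH' hHB' => ?_⟩
    have hHt' : ∀ s, ∀ w ∈ cell S φ,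
        HasDerivAt (H s) (develop (integrand l m ε s) (initial γ t') w) w := fun s w hw => by
      rw [← initial_trans γ t t', (isCell_cell S φ).develop_trans_path _ _ _ (fun v => ?_) hw]
      · exact hH s w hw
      · obtain ⟨v', hv', hv⟩ := (Path.range_subpath γ t t').le ⟨v, rfl⟩
        exact hv ▸ hmem v' hv'
    -- `H` and `H'` differ by a constant on the convex overlap; its value at the marked point there
    -- lies in `W`.
    have hbm := hb φ ψ ⟨_, hφ', hψ⟩
    have hbB : b (φ, ψ) ∈ B := Set.mem_insert_of_mem _ ⟨_, rfl⟩
    have h1 := hP φ hφ H hH fun z hz => hle φ (hHB z hz)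
    have h2 := W.sub_mem (hle φ (hHB _ hbB)) (hHB' _ hbB)
    convert W.add_mem h1 h2 using 1
    funext s
    have hsub := ((isCell_cell S φ).inter (isCell_cell S ψ)).primitive_sub_eq
      (fun w hw => hHt' s w hw.1) (fun w hw => hH' s w hw.2) ⟨hφ', hψ⟩ hbm
    have hadd := intervalIntegral.integral_add_adjacent_intervals (hint s) (hFTC s).1
    rw [(hFTC s).2] at hadd
    simp only [Pi.add_apply, Pi.sub_apply]
    linear_combination hsub - hadd
  · refine ⟨fun s => by simp, fun φ hφ H hH hHB => ?_⟩
    convert W.neg_mem (hHB p.1 (Set.mem_insert _ _)) using 1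
    funext s
    simp

variable (𝓛 : KStructure K D p) (l : LogBranch p) (m : M)

/-- `G` is a sum of integrals over a chain which is a cycle. -/
def IsGammaSum (G : ℂ → ℂ) : Prop :=
  ∃ (k : ℕ) (σ : Fin k → Path p p) (ε : Fin k → 𝓛.L) (n : Fin k → ℤ),
    (∀ j, PiecewiseC1 (σ j)) ∧
    ∑ j, chain 𝓛 (FundamentalGroup.fromPath (Path.Homotopic.Quotient.mk (σ j)))
      (Stalk.tmul 𝓛 (eR K (n j)) (ε j)) ∈ groupHomology.cycles₁ (Rep.of (stalkMonodromy 𝓛 l)) ∧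
    ∀ s, G s = ∑ j, e (n j) s * loopIntegral (integrand l m (ε j) s) (σ j)

lemma isGammaSum_iff (G : ℂ → ℂ) :
    IsGammaSum 𝓛 l m G ↔ ∃ ξ : H1 𝓛 l, IsGammaFunction 𝓛 l m ξ G := by
  constructor
  · rintro ⟨k, σ, ε, n, hσ, hz, hG⟩
    exact ⟨_, k, σ, ε, n, ⟨_, hz⟩, hσ, rfl, rfl, hG⟩
  · rintro ⟨ξ, k, σ, ε, n, z, hσ, hz, -, hG⟩
    exact ⟨k, σ, ε, n, hσ, hz ▸ z.2, hG⟩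

variable {𝓛 l m}

lemma IsGammaSum.zero : IsGammaSum 𝓛 l m 0 :=
  ⟨0, Fin.elim0, Fin.elim0, Fin.elim0, fun j => j.elim0, by simp, by simp⟩

lemma IsGammaSum.add {G G' : ℂ → ℂ} (h : IsGammaSum 𝓛 l m G) (h' : IsGammaSum 𝓛 l m G') :
    IsGammaSum 𝓛 l m (G + G') := by
  obtain ⟨k, σ, ε, n, hσ, hz, hG⟩ := h
  obtain ⟨k', σ', ε', n', hσ', hz', hG'⟩ := h'
  refine ⟨k + k', Fin.append σ σ', Fin.append ε ε', Fin.append n n', fun j => ?_, ?_, fun s => ?_⟩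
  · induction j using Fin.addCases with
    | left i => simpa using hσ i
    | right i => simpa using hσ' i
  · simpa [Fin.sum_univ_add] using add_mem hz hz'
  · simp [Fin.sum_univ_add, hG, hG']

lemma IsGammaSum.e_mul {G : ℂ → ℂ} (h : IsGammaSum 𝓛 l m G) (i : ℤ) :
    IsGammaSum 𝓛 l m (e i * G) := by
  obtain ⟨k, σ, ε, n, hσ, hz, hG⟩ := h
  refine ⟨k, σ, ε, fun j => i + n j, hσ, ?_, fun s => ?_⟩
  · have hc : ∀ j, chain 𝓛 (FundamentalGroup.fromPath (Path.Homotopic.Quotient.mk (σ j)))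
        (Stalk.tmul 𝓛 (eR K (i + n j)) (ε j)) = eR K i •
          chain 𝓛 (FundamentalGroup.fromPath (Path.Homotopic.Quotient.mk (σ j)))
            (Stalk.tmul 𝓛 (eR K (n j)) (ε j)) := fun j => by
      rw [eR_add, chain, chain, Finsupp.smul_single]
      rfl
    simp only [hc, ← Finset.smul_sum]
    exact Submodule.smul_mem _ _ hz
  · simp only [Pi.mul_apply, hG, Finset.mul_sum, e_add, mul_assoc]

/-- Only powers of `e^{2πis}` may stand before the integrals, so the constant is absorbed into the
`ε j`. -/
lemma IsGammaSum.const_mul {G : ℂ → ℂ} (h : IsGammaSum 𝓛 l m G) (a : K) :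
    IsGammaSum 𝓛 l m (algebraMap K (ℂ → ℂ) a * G) := by
  obtain ⟨k, σ, ε, n, hσ, hz, hG⟩ := h
  refine ⟨k, σ, fun j => a • ε j, n, hσ, ?_, fun s => ?_⟩
  · have hc : ∀ j, chain 𝓛 (FundamentalGroup.fromPath (Path.Homotopic.Quotient.mk (σ j)))
        (Stalk.tmul 𝓛 (eR K (n j)) (a • ε j)) = algebraMap K (R K) a •
          chain 𝓛 (FundamentalGroup.fromPath (Path.Homotopic.Quotient.mk (σ j)))
            (Stalk.tmul 𝓛 (eR K (n j)) (ε j)) := fun j => by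
      rw [chain, chain, Finsupp.smul_single]
      congr 1
      change eR K (n j) ⊗ₜ[K] (a • ε j) = (algebraMap K (R K) a * eR K (n j)) ⊗ₜ[K] ε j
      rw [← Algebra.smul_def, TensorProduct.smul_tmul]
    simp only [hc, ← Finset.smul_sum]
    exact Submodule.smul_mem _ _ hz
  · have hl : ∀ j, loopIntegral (integrand l m (a • ε j) s) (σ j) =
        a * loopIntegral (integrand l m (ε j) s) (σ j) := fun j => by
      rw [loopIntegral_eq, loopIntegral_eq, ← intervalIntegral.integral_const_mul]
      congr 1
      funext x
      simp only [pulledBack, ← mul_assoc]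
      congr 1
      exact mul_assoc _ _ _
    simp only [hl, Pi.mul_apply, hG, Finset.mul_sum]
    exact Finset.sum_congr rfl fun j _ => mul_left_comm _ _ _

lemma IsGammaSum.smul {G : ℂ → ℂ} (h : IsGammaSum 𝓛 l m G) (r : R K) :
    IsGammaSum 𝓛 l m (r • G) := by
  obtain ⟨r, hr⟩ := r
  change IsGammaSum 𝓛 l m (r * G)
  induction hr using Algebra.adjoin_induction generalizing G with
  | mem x hx =>
    rcases hx with rfl | rfl
    · exact h.e_mul 1
    · exact h.e_mul (-1)
  | algebraMap a => exact h.const_mul a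
  | add x y _ _ hx hy => rw [add_mul]; exact (hx h).add (hy h)
  | mul x y _ _ hx hy => rw [mul_assoc]; exact hx (hy h)

variable (𝓛 l m) in
/-- The module of gamma functions. -/
def gammaModule : Submodule (R K) (ℂ → ℂ) where
  carrier := {G | IsGammaSum 𝓛 l m G}
  zero_mem' := .zero
  add_mem' := .add
  smul_mem' r _ h := h.smul r

lemma isNoetherianRing_R (K : Subfield ℂ) : IsNoetherianRing (R K) :=
  isNoetherianRing_of_fg (Subalgebra.fg_def.2 ⟨_, Set.toFinite _, rfl⟩)

/-- Every term of a gamma sum lies in the finitely generated `W`, and submodules of `W` are finitely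
generated because `R K` is Noetherian. -/
lemma gammaModule_fg [Module.Finite (Reg S) M] : (gammaModule 𝓛 l m).FG := by
  have := 𝓛.finite
  have := isNoetherianRing_R K
  obtain ⟨W, hW, hmem⟩ := exists_fg_loopIntegral_mem 𝓛 l m
  have := isNoetherian_of_fg_of_noetherian W hW
  refine Submodule.FG.of_le_of_isNoetherian (T := W) ?_
  rintro G ⟨k, σ, ε, n, hσ, -, hG⟩
  have h : G = ∑ j, eR K (n j) • fun s => loopIntegral (integrand l m (ε j) s) (σ j) := by
    funext s
    rw [hG, Finset.sum_apply]
    rfl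
  rw [h]
  exact Submodule.sum_mem _ fun j _ => Submodule.smul_mem _ _ (hmem _ (hσ j) _)

end Gamma

end MotivicGamma

end

theorem mainTheorem12 (S : Finset ℂ) (K : Subfield ℂ)
    {M : Type} [AddCommGroup M] [Module (MotivicGamma.Reg S) M]
    [Module.Finite (MotivicGamma.Reg S) M] [Module.Projective (MotivicGamma.Reg S) M]
    (D : MotivicGamma.AlgConnection S M) (p : MotivicGamma.Curve S)
    (𝓛 : MotivicGamma.KStructure K D p) (l : MotivicGamma.LogBranch p) (m : M) :
    ∃ N : Submodule (MotivicGamma.R K) (ℂ → ℂ),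
      (∀ G : ℂ → ℂ, G ∈ N ↔
        ∃ ξ : MotivicGamma.H1 𝓛 l, MotivicGamma.IsGammaFunction 𝓛 l m ξ G) ∧
      N.FG :=
  ⟨MotivicGamma.gammaModule 𝓛 l m, MotivicGamma.isGammaSum_iff 𝓛 l m,
    MotivicGamma.gammaModule_fg⟩
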